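/- Let $(\tau_n)_{n\ge 0}$ be a decreasing (not necessarily strictly) sequence of positive real numbers with $\tau_0=1$ and $\lim_{n\to\infty}\tau_n=0$. Then there exists a symmetric (i.e. invariant under $x\mapsto -x$) probability measure $\mu$ on $\mathbb R$ with infinite support and moments $s_n=\int x^n\,d\mu(x)$ of every order $n\ge 0$, which is determinate (no other positive measure on $\mathbb R$ has the same moments), such that for all $N\ge 0$ the smallest eigenvalue $$\lambda_N=\min\Big\{\sum_{n,m=0}^N s_{n+m}\,a_m\overline{a_n}\ \Big|\ a\in\mathbb C^{N+1},\ \|a\|=1\Big\}$$ of the Hankel matrix $\mathcal H_N=(s_{n+m})_{n,m=0}^N$ satisfies $\lambda_N\le\tau_N$. In particular, $\lambda_N$ can decay arbitrarily fast. -/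

import Mathlib

open MeasureTheory Filter Topology

noncomputable section

namespace HankelMoment

/-- `μ` has moments of every order. (The case `n = 0` says that `μ` is finite.) -/
def HasAllMoments (μ : Measure ℝ) : Prop :=
  ∀ n : ℕ, Integrable (fun x : ℝ => x ^ n) μ

/-- The moment `s_n = ∫ x ^ n dμ(x)`. -/
def moment (μ : Measure ℝ) (n : ℕ) : ℝ := ∫ x, x ^ n ∂μ

/-- The measure `μ` is determinate: it has moments of every order, and it is the only positive
measure on the real line with these moments. -/
def IsDeterminate (μ : Measure ℝ) : Prop :=
  HasAllMoments μ ∧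
    ∀ ν : Measure ℝ, HasAllMoments ν → (∀ n : ℕ, moment ν n = moment μ n) → ν = μ

/-- `μ` is symmetric: invariant under `x ↦ -x`. -/
def IsSymmetricMeasure (μ : Measure ℝ) : Prop :=
  Measure.map (fun x : ℝ => -x) μ = μ

/-- The Hankel matrix `H_N = (s_{n+m})` with `0 ≤ n, m ≤ N`. -/
def hankel (μ : Measure ℝ) (N : ℕ) : Matrix (Fin (N + 1)) (Fin (N + 1)) ℝ :=
  Matrix.of fun n m => moment μ (n + m)

/-- The value `⟨H_N a, a⟩ = ∑ s_{n+m} a_m conj(a_n)` for `a ∈ ℂ^(N+1)`; it is a real number because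
`H_N` is real and symmetric, so nothing is lost by taking the real part. -/
def hankelForm (μ : Measure ℝ) (N : ℕ) (a : EuclideanSpace ℂ (Fin (N + 1))) : ℝ :=
  (inner ℂ a (Matrix.toEuclideanLin ((hankel μ N).map (fun t : ℝ => (t : ℂ))) a)).re

/-- The smallest eigenvalue `λ_N = min {⟨H_N a, a⟩ | a ∈ ℂ^(N+1), ‖a‖ = 1}`. -/
def smallestEigenvalue (μ : Measure ℝ) (N : ℕ) : ℝ :=
  sInf (hankelForm μ N '' {a | ‖a‖ = 1})

/-- The infimum in the definition of `λ_N` is a minimum. -/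
theorem isLeast_smallestEigenvalue (μ : Measure ℝ) (N : ℕ) :
    IsLeast (hankelForm μ N '' {a | ‖a‖ = 1}) (smallestEigenvalue μ N) := by
  have hs : {a : EuclideanSpace ℂ (Fin (N + 1)) | ‖a‖ = 1} = Metric.sphere 0 1 := by
    ext a; simp
  unfold smallestEigenvalue
  rw [hs]
  apply IsCompact.isLeast_sInf
  · apply (isCompact_sphere _ _).image
    have h := LinearMap.continuous_of_finiteDimensional
      (Matrix.toEuclideanLin ((hankel μ N).map (fun t : ℝ => (t : ℂ))))
    exact Complex.continuous_re.comp (continuous_id.inner h)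
  · exact (NormedSpace.sphere_nonempty.2 zero_le_one).image _

end HankelMoment

end

/-! The measure is purely atomic: symmetrize `∑ p k • δ_{1/k}`, where `p k = 2^{-(k+1)} τ_{2k}` for
`k ≥ 1` and the remaining mass sits at `0`. A monic polynomial `P` of degree at most `N` has a
coefficient vector of norm at least `1`, so `λ_N ≤ ∫ P² dμ`. Take `P = nodePoly K`, which vanishes
at `0` and `±1/k` for `k ≤ K` and is bounded by `1` on `[-1, 1]`: only the masses with `k > K`
survive, and they add up to at most `τ_{2K+2}`.

Determinacy comes from compact support: bounded even moments force any competitor onto `[-1, 1]`,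
where polynomials are uniformly dense. -/

open Polynomial in
/-- A monic polynomial of degree at most `N` bounds the smallest eigenvalue of `H_N`. -/
theorem HankelMoment.smallestEigenvalue_le_integral_sq {μ : Measure ℝ}
    (hμ : HankelMoment.HasAllMoments μ) {N : ℕ} {p : ℝ[X]} (hp : p.Monic)
    (hdeg : p.natDegree ≤ N) :
    HankelMoment.smallestEigenvalue μ N ≤ ∫ x, (p.eval x) ^ 2 ∂μ := by
  set a : EuclideanSpace ℂ (Fin (N + 1)) := WithLp.toLp 2 fun i => ((p.coeff i : ℝ) : ℂ) with ha
  have hform : HankelMoment.hankelForm μ N a = ∫ x, (p.eval x) ^ 2 ∂μ := by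
    have hint : ∀ i j : Fin (N + 1),
        Integrable (fun x : ℝ => p.coeff i * p.coeff j * x ^ ((i : ℕ) + j)) μ :=
      fun i j => (hμ _).const_mul _
    have h1 : ∀ x : ℝ, (p.eval x) ^ 2 =
        ∑ i : Fin (N + 1), ∑ j : Fin (N + 1), p.coeff i * p.coeff j * x ^ ((i : ℕ) + j) := by
      intro x
      rw [eval_eq_sum_range' (Nat.lt_succ_of_le hdeg), sq, ← Fin.sum_univ_eq_sum_range
        (fun i => p.coeff i * x ^ i), Finset.sum_mul_sum]
      refine Finset.sum_congr rfl fun i _ => Finset.sum_congr rfl fun j _ => ?_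
      rw [pow_add]; ring
    simp_rw [h1]
    rw [integral_finsetSum _ fun i _ => integrable_finsetSum _ fun j _ => hint i j]
    simp_rw [integral_finsetSum _ fun j _ => hint _ j, integral_const_mul]
    rw [HankelMoment.hankelForm, PiLp.inner_apply, Complex.re_sum]
    refine Finset.sum_congr rfl fun i _ => ?_
    simp only [ha, Matrix.toEuclideanLin, Matrix.toLpLin_apply, Matrix.mulVec, dotProduct,
      Matrix.map_apply, HankelMoment.hankel, Matrix.of_apply, HankelMoment.moment,
      RCLike.inner_apply, Complex.conj_ofReal]
    norm_cast
    rw [Finset.sum_mul]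
    exact Finset.sum_congr rfl fun j _ => by ring_nf
  -- The leading coefficient `1` is an entry of `a`, so normalizing `a` can only decrease the
  -- nonnegative form.
  have hnorm : 1 ≤ ‖a‖ := by
    have := PiLp.norm_apply_le a ⟨p.natDegree, Nat.lt_succ_of_le hdeg⟩
    simpa [ha, hp.coeff_natDegree] using this
  have hpos : 0 < ‖a‖ := by linarith
  have hmem : HankelMoment.hankelForm μ N (((‖a‖⁻¹ : ℝ) : ℂ) • a) ∈
      HankelMoment.hankelForm μ N '' {a | ‖a‖ = 1} := by
    refine ⟨_, ?_, rfl⟩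
    simp [norm_smul, hpos.ne']
  have hle := (HankelMoment.isLeast_smallestEigenvalue μ N).2 hmem
  have hscale : HankelMoment.hankelForm μ N (((‖a‖⁻¹ : ℝ) : ℂ) • a) =
      ‖a‖⁻¹ ^ 2 * HankelMoment.hankelForm μ N a := by
    rw [HankelMoment.hankelForm, HankelMoment.hankelForm, map_smul, inner_smul_left,
      inner_smul_right, Complex.conj_ofReal, Complex.re_ofReal_mul, Complex.re_ofReal_mul]
    ring
  rw [hscale, hform] at hle
  refine hle.trans (mul_le_of_le_one_left (integral_nonneg fun x => sq_nonneg _) ?_)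
  exact pow_le_one₀ (by positivity) (inv_le_one_of_one_le₀ hnorm)

/-! ### Determinacy of measures on `[-1, 1]` -/

/-- A finite measure with bounded even moments is carried by `[-1, 1]`. -/
theorem ae_mem_Icc_of_moment_le {ν : Measure ℝ} [IsFiniteMeasure ν]
    (hν : HankelMoment.HasAllMoments ν) {C : ℝ}
    (h : ∀ n, HankelMoment.moment ν (2 * n) ≤ C) : ∀ᵐ x ∂ν, x ∈ Set.Icc (-1 : ℝ) 1 := by
  have key : ∀ k : ℕ, ∀ᵐ x ∂ν, |x| < 1 + 1 / ((k : ℝ) + 1) := by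
    intro k
    set r : ℝ := 1 + 1 / ((k : ℝ) + 1) with hr
    have hr1 : 1 < r := by
      have : (0 : ℝ) < 1 / ((k : ℝ) + 1) := by positivity
      linarith
    -- Markov's inequality for `x ^ (2 * n)`; since `r > 1`, letting `n` grow forces the tail to be
    -- null.
    have hbound : ∀ n : ℕ, (r ^ 2) ^ n * ν.real {x | r ≤ |x|} ≤ C := by
      intro n
      have hpow : ∀ x : ℝ, 0 ≤ x ^ (2 * n) := fun x => by rw [pow_mul]; positivity
      refine le_trans ?_ ((mul_meas_ge_le_integral_of_nonneg (ae_of_all _ hpow)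
        (hν (2 * n)) ((r ^ 2) ^ n)).trans (h n))
      refine mul_le_mul_of_nonneg_left (measureReal_mono ?_) (by positivity)
      intro x hx
      have hx' : r ≤ |x| := hx
      change (r ^ 2) ^ n ≤ x ^ (2 * n)
      rw [pow_mul, ← sq_abs x]
      gcongr
    have hzero : ν.real {x | r ≤ |x|} = 0 := by
      by_contra hne
      have hpos : 0 < ν.real {x | r ≤ |x|} := lt_of_le_of_ne measureReal_nonneg (Ne.symm hne)
      obtain ⟨n, hn⟩ := pow_unbounded_of_one_lt (C / ν.real {x | r ≤ |x|})
        (one_lt_pow₀ hr1 two_ne_zero)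
      rw [div_lt_iff₀ hpos] at hn
      exact absurd (hbound n) (not_le.2 hn)
    rw [measureReal_eq_zero_iff] at hzero
    simpa [ae_iff, not_lt] using hzero
  filter_upwards [ae_all_iff.2 key] with x hx
  rw [Set.mem_Icc, ← abs_le]
  have hlim : Tendsto (fun k : ℕ => 1 + 1 / ((k : ℝ) + 1)) atTop (𝓝 (1 + 0)) :=
    tendsto_const_nhds.add tendsto_one_div_add_atTop_nhds_zero_nat
  simpa using ge_of_tendsto' hlim fun k => (hx k).le

open Polynomial in
theorem HankelMoment.HasAllMoments.integrable_eval {μ : Measure ℝ}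
    (hμ : HankelMoment.HasAllMoments μ) (p : ℝ[X]) : Integrable (fun x => p.eval x) μ := by
  simp_rw [eval_eq_sum_range]
  exact integrable_finsetSum _ fun i _ => (hμ i).const_mul _

open Polynomial in
theorem HankelMoment.HasAllMoments.integral_eval {μ : Measure ℝ}
    (hμ : HankelMoment.HasAllMoments μ) (p : ℝ[X]) :
    ∫ x, p.eval x ∂μ = ∑ i ∈ Finset.range (p.natDegree + 1),
      p.coeff i * HankelMoment.moment μ i := by
  simp_rw [eval_eq_sum_range]
  rw [integral_finsetSum _ fun i _ => (hμ i).const_mul _]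
  simp_rw [integral_const_mul, HankelMoment.moment]

theorem HankelMoment.HasAllMoments.isFiniteMeasure {μ : Measure ℝ}
    (hμ : HankelMoment.HasAllMoments μ) : IsFiniteMeasure μ := by
  have h := hμ 0
  simp only [pow_zero] at h
  exact (integrable_const_iff_isFiniteMeasure one_ne_zero).1 h

theorem hasAllMoments_of_ae_mem_Icc {μ : Measure ℝ} [IsFiniteMeasure μ]
    (h : ∀ᵐ x ∂μ, x ∈ Set.Icc (-1 : ℝ) 1) : HankelMoment.HasAllMoments μ := by
  intro n
  refine Integrable.of_bound (by fun_prop) 1 ?_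
  filter_upwards [h] with x hx
  rw [Real.norm_eq_abs, abs_pow]
  exact pow_le_one₀ (abs_nonneg x) (abs_le.2 hx)

/-- A finite measure carried by `[-1, 1]` is determinate. -/
theorem isDeterminate_of_ae_mem_Icc {μ : Measure ℝ} [IsFiniteMeasure μ]
    (h : ∀ᵐ x ∂μ, x ∈ Set.Icc (-1 : ℝ) 1) : HankelMoment.IsDeterminate μ := by
  have hμ := hasAllMoments_of_ae_mem_Icc h
  refine ⟨hμ, fun ν hν hmom => ?_⟩
  have := hν.isFiniteMeasure
  have hνIcc : ∀ᵐ x ∂ν, x ∈ Set.Icc (-1 : ℝ) 1 := by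
    refine ae_mem_Icc_of_moment_le hν (C := μ.real Set.univ) fun n => ?_
    rw [hmom, HankelMoment.moment]
    have hle : ∫ x, x ^ (2 * n) ∂μ ≤ ∫ _, (1 : ℝ) ∂μ := by
      refine integral_mono_ae (hμ _) (integrable_const _) ?_
      filter_upwards [h] with x hx
      rw [pow_mul, ← sq_abs]
      exact pow_le_one₀ (by positivity) (pow_le_one₀ (abs_nonneg x) (abs_le.2 hx))
    simpa using hle
  refine ext_of_forall_integral_eq_of_IsFiniteMeasure fun f => ?_
  have happrox : ∀ (κ : Measure ℝ) [IsFiniteMeasure κ], HankelMoment.HasAllMoments κ →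
      (∀ᵐ x ∂κ, x ∈ Set.Icc (-1 : ℝ) 1) → ∀ (p : Polynomial ℝ) (ε : ℝ),
      (∀ x ∈ Set.Icc (-1 : ℝ) 1, |p.eval x - f x| < ε) →
      |∫ x, p.eval x ∂κ - ∫ x, f x ∂κ| ≤ ε * κ.real Set.univ := by
    intro κ _ hκ hκI p ε hp
    rw [← integral_sub (hκ.integrable_eval p) (f.integrable κ), ← Real.norm_eq_abs]
    refine norm_integral_le_of_norm_le_const ?_
    filter_upwards [hκI] with x hx using (hp x hx).le
  refine eq_of_forall_dist_le fun ε hε => ?_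
  -- The `+ 1` keeps `M` positive even when both measures vanish.
  set M := ν.real Set.univ + μ.real Set.univ + 1 with hM
  have hMpos : 0 < M := by positivity
  obtain ⟨p, hp⟩ := exists_polynomial_near_of_continuousOn (-1) 1 f
    f.continuous.continuousOn (ε / M) (by positivity)
  have h1 := happrox ν hν hνIcc p _ hp
  have h2 := happrox μ hμ h p _ hp
  have h3 : ∫ x, p.eval x ∂ν = ∫ x, p.eval x ∂μ := by
    simp_rw [hν.integral_eval, hμ.integral_eval, hmom]
  rw [h3] at h1
  rw [Real.dist_eq]
  calc |∫ x, f x ∂ν - ∫ x, f x ∂μ|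
      ≤ |∫ x, p.eval x ∂μ - ∫ x, f x ∂ν| + |∫ x, p.eval x ∂μ - ∫ x, f x ∂μ| := by
        rw [abs_sub_comm (∫ x, p.eval x ∂μ) (∫ x, f x ∂ν)]
        exact abs_sub_le _ _ _
    _ ≤ ε / M * ν.real Set.univ + ε / M * μ.real Set.univ := add_le_add h1 h2
    _ ≤ ε / M * M := by
        rw [← mul_add]
        exact mul_le_mul_of_nonneg_left (by linarith) (by positivity)
    _ = ε := div_mul_cancel₀ _ hMpos.ne'

/-! ### Symmetrization -/

/-- The average of a measure on the line and its reflection. -/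
noncomputable def symmetrization (ν : Measure ℝ) : Measure ℝ :=
  (2⁻¹ : ENNReal) • (ν + ν.map (fun x => -x))

theorem isSymmetricMeasure_symmetrization (ν : Measure ℝ) :
    HankelMoment.IsSymmetricMeasure (symmetrization ν) := by
  rw [HankelMoment.IsSymmetricMeasure, symmetrization, Measure.map_smul,
    Measure.map_add _ _ measurable_neg, Measure.map_map measurable_neg measurable_neg]
  simp [add_comm]

theorem isProbabilityMeasure_symmetrization (ν : Measure ℝ) [IsProbabilityMeasure ν] :
    IsProbabilityMeasure (symmetrization ν) := by
  have : IsProbabilityMeasure (ν.map fun x => -x) :=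
    Measure.isProbabilityMeasure_map measurable_neg.aemeasurable
  constructor
  simp [symmetrization, ENNReal.inv_two_add_inv_two]

theorem ae_symmetrization_iff {ν : Measure ℝ} {P : ℝ → Prop} (hP : MeasurableSet {x | P x})
    (heven : ∀ x, P (-x) ↔ P x) : (∀ᵐ x ∂symmetrization ν, P x) ↔ ∀ᵐ x ∂ν, P x := by
  rw [symmetrization, Measure.ae_ennreal_smul_measure_iff (by simp), ae_add_measure_iff,
    ae_map_iff measurable_neg.aemeasurable hP]
  simp [heven]

theorem integral_symmetrization_of_even {ν : Measure ℝ} {f : ℝ → ℝ} (hf : Integrable f ν)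
    (heven : ∀ x, f (-x) = f x) : ∫ x, f x ∂symmetrization ν = ∫ x, f x ∂ν := by
  have hmap : MeasurableEmbedding (fun x : ℝ => -x) := (MeasurableEquiv.neg ℝ).measurableEmbedding
  have hint : Integrable f (ν.map fun x => -x) := by
    rw [hmap.integrable_map_iff]
    simpa [Function.comp_def, heven] using hf
  rw [symmetrization, integral_smul_measure, integral_add_measure hf hint, hmap.integral_map]
  simp only [heven, ENNReal.toReal_inv, ENNReal.toReal_ofNat, smul_eq_mul]
  ring

/-! ### Polynomials vanishing at the first atoms -/

open Polynomial in
/-- The odd monic polynomial of degree `2 K + 1` with the zeros `0` and `± 1 / k`, `1 ≤ k ≤ K`. -/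
noncomputable def nodePoly (K : ℕ) : ℝ[X] :=
  X * ∏ k ∈ Finset.range K, (X ^ 2 - C ((((k + 1 : ℕ) : ℝ)⁻¹) ^ 2))

open Polynomial in
theorem monic_nodePoly (K : ℕ) : (nodePoly K).Monic :=
  monic_X.mul (monic_prod_of_monic _ _ fun _ _ => monic_X_pow_sub_C _ two_ne_zero)

open Polynomial in
theorem natDegree_nodePoly (K : ℕ) : (nodePoly K).natDegree = 2 * K + 1 := by
  rw [nodePoly, natDegree_X_mul
    (monic_prod_of_monic _ _ fun _ _ => monic_X_pow_sub_C _ two_ne_zero).ne_zero,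
    natDegree_prod_of_monic _ _ fun _ _ => monic_X_pow_sub_C _ two_ne_zero]
  simp only [natDegree_X_pow_sub_C, Finset.sum_const, Finset.card_range, smul_eq_mul]
  ring

open Polynomial in
theorem eval_nodePoly (K : ℕ) (x : ℝ) : (nodePoly K).eval x =
    x * ∏ k ∈ Finset.range K, (x ^ 2 - (((k + 1 : ℕ) : ℝ)⁻¹) ^ 2) := by
  simp [nodePoly, eval_prod]

theorem eval_neg_nodePoly_sq (K : ℕ) (x : ℝ) :
    ((nodePoly K).eval (-x)) ^ 2 = ((nodePoly K).eval x) ^ 2 := by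
  simp only [eval_nodePoly, neg_sq, neg_mul]

theorem eval_nodePoly_inv_of_le {K j : ℕ} (hj : j ≤ K) :
    (nodePoly K).eval ((j : ℝ)⁻¹) = 0 := by
  rw [eval_nodePoly]
  rcases j with _ | j
  -- Here `0⁻¹ = 0`, which is the root of the factor `X`.
  · simp
  · rw [Finset.prod_eq_zero (Finset.mem_range.2 hj) (sub_self _), mul_zero]

/-- Each factor other than `x` is a difference of two numbers in `[0, 1]`. -/
theorem eval_nodePoly_sq_le_one (K : ℕ) {x : ℝ} (hx : |x| ≤ 1) :
    ((nodePoly K).eval x) ^ 2 ≤ 1 := by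
  rw [sq_le_one_iff_abs_le_one, eval_nodePoly, abs_mul, Finset.abs_prod]
  refine mul_le_one₀ hx (Finset.prod_nonneg fun _ _ => abs_nonneg _)
    (Finset.prod_le_one (fun _ _ => abs_nonneg _) fun k _ => ?_)
  have h1 : x ^ 2 ≤ 1 := (sq_le_one_iff_abs_le_one x).2 hx
  have h2 : (((k + 1 : ℕ) : ℝ)⁻¹) ^ 2 ≤ 1 :=
    pow_le_one₀ (by positivity) (Nat.cast_inv_le_one (k + 1))
  rw [abs_le]
  constructor <;> nlinarith [sq_nonneg x, sq_nonneg (((k + 1 : ℕ) : ℝ)⁻¹)]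

/-! ### The atomic measure and its eigenvalue bound -/

/-- The image under `k ↦ 1 / k` (and `0 ↦ 0`) of the probability `p` on `ℕ`. -/
noncomputable def invMeasure (p : PMF ℕ) : Measure ℝ := p.toMeasure.map fun k : ℕ => (k : ℝ)⁻¹

instance (p : PMF ℕ) : IsProbabilityMeasure (invMeasure p) :=
  Measure.isProbabilityMeasure_map (by fun_prop)

theorem abs_natCast_inv_le_one (k : ℕ) : |((k : ℝ)⁻¹)| ≤ 1 := by
  rw [abs_of_nonneg (by positivity)]
  exact Nat.cast_inv_le_one k

theorem ae_invMeasure_mem_Icc (p : PMF ℕ) : ∀ᵐ x ∂invMeasure p, x ∈ Set.Icc (-1 : ℝ) 1 := by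
  rw [invMeasure, ae_map_iff (p := fun x => x ∈ Set.Icc (-1 : ℝ) 1) (by fun_prop) measurableSet_Icc]
  exact ae_of_all _ fun k => abs_le.1 (abs_natCast_inv_le_one k)

theorem ae_symmetrization_invMeasure_mem_Icc (p : PMF ℕ) :
    ∀ᵐ x ∂symmetrization (invMeasure p), x ∈ Set.Icc (-1 : ℝ) 1 := by
  refine (ae_symmetrization_iff measurableSet_Icc fun x => ?_).2 (ae_invMeasure_mem_Icc p)
  rw [← abs_le, abs_neg, abs_le]

theorem infinite_support_symmetrization_invMeasure {p : PMF ℕ} (hp : ∀ k, p (k + 1) ≠ 0) :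
    (symmetrization (invMeasure p)).support.Infinite := by
  refine Set.infinite_of_injective_forall_mem (f := fun k : ℕ => (((k + 1 : ℕ) : ℝ)⁻¹)) ?_ ?_
  · intro a b hab
    simpa using hab
  · intro k
    rw [Measure.mem_support_iff_forall]
    intro U hU
    refine lt_of_lt_of_le ?_ (measure_mono (Set.singleton_subset_iff.2 (mem_of_mem_nhds hU)))
    have h1 : p (k + 1) ≤ invMeasure p {(((k + 1 : ℕ) : ℝ)⁻¹)} := by
      rw [invMeasure, Measure.map_apply (by fun_prop) (measurableSet_singleton _),
        ← p.toMeasure_apply_singleton (k + 1) (measurableSet_singleton _)]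
      exact measure_mono (by simp)
    have h2 : 0 < invMeasure p {(((k + 1 : ℕ) : ℝ)⁻¹)} := (pos_iff_ne_zero.2 (hp k)).trans_le h1
    rw [symmetrization, Measure.smul_apply, Measure.add_apply, smul_eq_mul]
    exact ENNReal.mul_pos (by simp) (h2.trans_le le_self_add).ne'

/-- Testing with `nodePoly K` kills the atoms `k ≤ K`; the others are dominated by a geometric
series with sum `t`. -/
theorem smallestEigenvalue_symmetrization_invMeasure_le {p : PMF ℕ} {K N : ℕ}
    (hN : 2 * K + 1 ≤ N) {t : ℝ} (hp : ∀ k, K < k → (p k).toReal ≤ (1 / 2) ^ (k + 1) * t)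
    (ht : 0 ≤ t) :
    HankelMoment.smallestEigenvalue (symmetrization (invMeasure p)) N ≤ t := by
  have := isProbabilityMeasure_symmetrization (invMeasure p)
  have hae := ae_symmetrization_invMeasure_mem_Icc p
  refine (HankelMoment.smallestEigenvalue_le_integral_sq (hasAllMoments_of_ae_mem_Icc hae)
    (monic_nodePoly K) ((natDegree_nodePoly K).trans_le hN)).trans ?_
  have hintν : Integrable (fun x => ((nodePoly K).eval x) ^ 2) (invMeasure p) := by
    simp_rw [← Polynomial.eval_pow]
    exact (hasAllMoments_of_ae_mem_Icc (ae_invMeasure_mem_Icc p)).integrable_eval _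
  have hint : Integrable (fun k : ℕ => ((nodePoly K).eval ((k : ℝ)⁻¹)) ^ 2) p.toMeasure := by
    rw [invMeasure] at hintν
    exact hintν.comp_measurable (by fun_prop)
  rw [integral_symmetrization_of_even hintν (eval_neg_nodePoly_sq K), invMeasure,
    integral_map (by fun_prop) hintν.aestronglyMeasurable, PMF.integral_eq_tsum _ _ hint]
  have hgeom : HasSum (fun k : ℕ => (1 / 2 : ℝ) ^ (k + 1) * t) t := by
    have h := ((hasSum_geometric_two.mul_left (1 / 2)).mul_right t)
    simpa [pow_succ', mul_assoc] using h
  have hle : ∀ k : ℕ, (p k).toReal • ((nodePoly K).eval ((k : ℝ)⁻¹)) ^ 2 ≤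
      (1 / 2 : ℝ) ^ (k + 1) * t := by
    intro k
    rcases le_or_gt k K with hk | hk
    · rw [eval_nodePoly_inv_of_le hk]
      simp only [ne_eq, OfNat.ofNat_ne_zero, not_false_eq_true, zero_pow, smul_zero]
      positivity
    · exact (mul_le_of_le_one_right ENNReal.toReal_nonneg
        (eval_nodePoly_sq_le_one K (abs_natCast_inv_le_one k))).trans (hp k hk)
  refine (Summable.tsum_le_tsum hle ?_ hgeom.summable).trans hgeom.tsum_eq.le
  exact Summable.of_nonneg_of_le
    (fun k => mul_nonneg ENNReal.toReal_nonneg (sq_nonneg _)) hle hgeom.summable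

/-- A probability on `ℕ` with prescribed masses `w k` off `0`. -/
theorem exists_pmf_of_tsum_le_one {w : ℕ → ENNReal} (hw : ∑' k, w k ≤ 1) :
    ∃ p : PMF ℕ, ∀ k, p (k + 1) = w k := by
  let v : ℕ → ENNReal := fun k => Nat.casesOn k (1 - ∑' k, w k) w
  have hv : ∑' k, v k = 1 := by
    rw [tsum_eq_zero_add' ENNReal.summable]
    exact tsub_add_cancel_of_le hw
  exact ⟨⟨v, hv ▸ ENNReal.summable.hasSum⟩, fun k => rfl⟩

theorem HankelMoment.HasAllMoments.smallestEigenvalue_le_one {μ : Measure ℝ}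
    [IsProbabilityMeasure μ] (hμ : HankelMoment.HasAllMoments μ) (N : ℕ) :
    HankelMoment.smallestEigenvalue μ N ≤ 1 := by
  simpa using HankelMoment.smallestEigenvalue_le_integral_sq hμ (N := N) Polynomial.monic_one
    (by simp)

theorem theorem2p4 (τ : ℕ → ℝ) (hτ_pos : ∀ n, 0 < τ n) (hτ_anti : Antitone τ)
    (hτ_zero : τ 0 = 1) (hτ_lim : Tendsto τ atTop (𝓝 0)) :
    ∃ μ : Measure ℝ,
      IsProbabilityMeasure μ ∧
      HankelMoment.IsSymmetricMeasure μ ∧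
      μ.support.Infinite ∧
      HankelMoment.IsDeterminate μ ∧
      ∀ N : ℕ, HankelMoment.smallestEigenvalue μ N ≤ τ N := by
  have hsum : ∑' k : ℕ, ENNReal.ofReal ((1 / 2) ^ (k + 2) * τ (2 * (k + 1))) ≤ 1 := by
    have hgeom : HasSum (fun k : ℕ => (1 / 2 : ℝ) ^ (k + 1)) 1 := by
      have h := hasSum_geometric_two.mul_left (1 / 2)
      simpa [pow_succ'] using h
    calc _ ≤ ∑' k : ℕ, ENNReal.ofReal ((1 / 2 : ℝ) ^ (k + 1)) := by
          refine ENNReal.tsum_le_tsum fun k => ENNReal.ofReal_le_ofReal ?_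
          have h1 : τ (2 * (k + 1)) ≤ 1 := hτ_zero ▸ hτ_anti (Nat.zero_le _)
          exact (mul_le_of_le_one_right (by positivity) h1).trans
            (pow_le_pow_of_le_one (by norm_num) (by norm_num) (by omega))
      _ = 1 := by
          rw [← ENNReal.ofReal_tsum_of_nonneg (fun k => by positivity) hgeom.summable,
            hgeom.tsum_eq, ENNReal.ofReal_one]
  obtain ⟨p, hp⟩ := exists_pmf_of_tsum_le_one hsum
  have hprob := isProbabilityMeasure_symmetrization (invMeasure p)
  have hae := ae_symmetrization_invMeasure_mem_Icc p
  refine ⟨symmetrization (invMeasure p), hprob, isSymmetricMeasure_symmetrization _,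
    infinite_support_symmetrization_invMeasure fun k => ?_, isDeterminate_of_ae_mem_Icc hae,
    fun N => ?_⟩
  · rw [hp]
    have := hτ_pos (2 * (k + 1))
    exact (ENNReal.ofReal_pos.2 (by positivity)).ne'
  · have hbound : ∀ K : ℕ, ∀ k, K < k →
        (p k).toReal ≤ (1 / 2) ^ (k + 1) * τ (2 * K + 2) := by
      rintro K (_ | k) hk
      · omega
      · have := hτ_pos (2 * (k + 1))
        rw [hp, ENNReal.toReal_ofReal (by positivity)]
        exact mul_le_mul_of_nonneg_left (hτ_anti (by omega)) (by positivity)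
    -- `nodePoly` has degree at least `1`, so `N = 0` is tested with the constant `1` instead.
    rcases N with _ | N
    · rw [hτ_zero]
      exact (hasAllMoments_of_ae_mem_Icc hae).smallestEigenvalue_le_one _
    -- With `K = N / 2`, `2 * K + 1 ≤ N + 1 ≤ 2 * K + 2`: the degree fits, and `τ (2 * K + 2) ≤ τ (N
    -- + 1)`.
    · exact (smallestEigenvalue_symmetrization_invMeasure_le (K := N / 2) (by omega)
        (hbound _) (hτ_pos _).le).trans (hτ_anti (by omega))
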